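/- All topological groups are assumed to be Hausdorff. A topological group $G$ is *$c$-compact* if for every topological group $H$ the projection $\pi_H\colon G\times H\to H$ maps closed subgroups of $G\times H$ onto closed subgroups of $H$. It is *maximally almost periodic* (MAP) if it admits a continuous injective homomorphism into a compact group, and *minimally almost periodic* (m.a.p.) if it has no non-trivial finite-dimensional unitary representations, i.e. every continuous homomorphism $G\to U(n)$, $n\ge 0$, is trivial. **Theorem.** The following statements are equivalent: 1. every $c$-compact group is compact; 2. every second countable $c$-compact group is MAP; 3. every second countable $c$-compact m.a.p. group is trivial. Moreover, every second countable $c$-compact group that is MAP is compact (so that "MAP" in (2) may be replaced by "MAP, and thus compact"). -/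

import Mathlib

universe u

/-- A topological group `G` is c-compact if for every Hausdorff topological group `H` the
projection `G × H → H` maps closed subgroups of `G × H` onto closed subgroups of `H`. -/
def IsCCompactGroup (G : Type u) [Group G] [TopologicalSpace G] : Prop :=
  ∀ (H : Type u) [Group H] [TopologicalSpace H] [IsTopologicalGroup H] [T2Space H]
    (S : Subgroup (G × H)), IsClosed (S : Set (G × H)) →
      IsClosed (S.map (MonoidHom.snd G H) : Set H)

/-- A topological group `G` is MAP (maximally almost periodic) if it admits a continuous
monomorphism into a compact Hausdorff topological group. -/
def IsMaximallyAlmostPeriodic (G : Type u) [Group G] [TopologicalSpace G] : Prop :=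
  ∃ (K : Type u) (_ : Group K) (_ : TopologicalSpace K) (_ : IsTopologicalGroup K)
    (_ : T2Space K) (_ : CompactSpace K) (m : G →* K), Continuous m ∧ Function.Injective m

/-- A topological group `G` is m.a.p. (minimally almost periodic) if it has no non-trivial
finite-dimensional unitary representations: every continuous homomorphism from `G` to some
`U(n)` is trivial. -/
def IsMinimallyAlmostPeriodic (G : Type u) [Group G] [TopologicalSpace G] : Prop :=
  ∀ (n : ℕ) (ρ : G →* Matrix.unitaryGroup (Fin n) ℂ), Continuous ρ → ∀ g : G, ρ g = 1

/-!
The moreover clause rests on two facts. A c-compact group is closed in every Hausdorff group it maps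
to (project the graph), and applied to the group of two-sided Cauchy sequences modulo null sequences
this shows that two-sided Cauchy sequences converge; hence a second countable c-compact group is
Polish (`IsCCompactGroup.polishSpace`). If it injects continuously into a compact group, its image
is closed, hence a compact group `K`. By the Lusin-Souslin theorem open sets of `G` have Borel image
in `K`, countably many translates of such an image cover `K`, so the image has positive Haar measure,
and Steinhaus' theorem shows that `G → K` is open onto its image
(`IsCCompactGroup.compactSpace_of_isMaximallyAlmostPeriodic`).

Reduction to second countable groups: if all second countable c-compact groups are compact, then so
is every ω-narrow c-compact group, because by Guran's theorem it embeds, with closed image, into a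
product of second countable quotients. In particular closed separable subgroups of a c-compact group
`G` are compact, which forces `G` to be ω-narrow: otherwise some sequence in `G` is uniformly
discrete, and so is not contained in a compact subgroup
(`IsCCompactGroup.compactSpace_of_forall_secondCountable`).

From m.a.p. groups to all second countable groups: let `N` be the intersection of all closed normal
subgroups of `G` with compact quotient. Since `G ⧸ N` injects continuously into a product of compact
groups, it is MAP, hence compact. The kernel `M` of all finite-dimensional unitary representations of `N`
is normal in `G`, and `N ⧸ M` is compact for the same reason. Hence `G ⧸ M` is compact, so `M = N`
and `N` is m.a.p. (`IsCCompactGroup.isMinimallyAlmostPeriodic_compactResidual`). If `N` is trivial,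
`G` is compact.

Conversely, a compact m.a.p. group is trivial by the Peter-Weyl theorem. For a unitary representation
`π` of a compact group on a Hilbert space and a vector `w`, the operator
`v ↦ ∫ ⟪π x w, v⟫ • π x w dx` is compact, self-adjoint and commutes with `π`, so that its eigenspaces
for nonzero eigenvalues are finite-dimensional subrepresentations
(`exists_unitary_matrix_hom_ne_one`).
-/

open Filter Set Topology MeasureTheory InnerProductSpace
open scoped Uniformity Pointwise

/-! ### Permanence properties of c-compact groups -/

section Permanence

variable {G : Type u} [Group G] [TopologicalSpace G]

theorem IsCCompactGroup.of_surjective (hG : IsCCompactGroup G) {Q : Type u} [Group Q]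
    [TopologicalSpace Q] (f : G →* Q) (hf : Continuous f) (hs : Function.Surjective f) :
    IsCCompactGroup Q := by
  intro H _ _ _ _ S hS
  have h := hG H (S.comap (f.prodMap (MonoidHom.id H)))
    (hS.preimage ((hf.comp continuous_fst).prodMk continuous_snd))
  convert h using 2
  ext y
  constructor
  · rintro ⟨⟨q, h⟩, hq, rfl⟩
    obtain ⟨g, rfl⟩ := hs q
    exact ⟨(g, h), hq, rfl⟩
  · rintro ⟨⟨g, h⟩, hg, rfl⟩
    exact ⟨(f g, h), hg, rfl⟩

theorem IsCCompactGroup.subgroup (hG : IsCCompactGroup G) (N : Subgroup G)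
    (hN : IsClosed (N : Set G)) : IsCCompactGroup N := by
  intro H _ _ _ _ S hS
  have hc : IsClosedMap (Prod.map N.subtype (id : H → H)) :=
    (hN.isClosedEmbedding_subtypeVal.prodMap Topology.IsClosedEmbedding.id).isClosedMap
  have h := hG H (S.map (N.subtype.prodMap (MonoidHom.id H))) (hc _ hS)
  rwa [Subgroup.map_map] at h

/-- The range of `f` is the projection of the graph of `f`, which is closed as `H` is Hausdorff. -/
theorem IsCCompactGroup.isClosed_range (hG : IsCCompactGroup G) {H : Type u} [Group H]
    [TopologicalSpace H] [IsTopologicalGroup H] [T2Space H] (f : G →* H) (hf : Continuous f) :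
    IsClosed (f.range : Set H) := by
  have h := hG H ((MonoidHom.id G).prod f).range (by
    convert isClosed_eq (hf.comp continuous_fst) continuous_snd using 1
    ext ⟨x, y⟩
    simp [Prod.ext_iff])
  rwa [← MonoidHom.range_comp, MonoidHom.snd_comp_prod] at h

theorem IsCCompactGroup.quotient (hG : IsCCompactGroup G) (N : Subgroup G) [N.Normal] :
    IsCCompactGroup (G ⧸ N) :=
  hG.of_surjective (QuotientGroup.mk' N) continuous_quotient_mk' (QuotientGroup.mk'_surjective N)

end Permanence

/-! ### Group topologies given by a neighbourhood filter of the identity -/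

section FilterTopology

/-- A filter satisfying the axioms of the neighbourhood filter of the identity is the neighbourhood
filter of the identity for some group topology, which need not be Hausdorff. -/
theorem exists_groupTopology_nhds_one_eq {G : Type*} [Group G] (F : Filter G) (h1 : pure 1 ≤ F)
    (hmul : Tendsto (fun p : G × G => p.1 * p.2) (F ×ˢ F) F)
    (hinv : Tendsto (fun x : G => x⁻¹) F F)
    (hconj : ∀ x₀ : G, Tendsto (fun x => x₀ * x * x₀⁻¹) F F) :
    ∃ t : TopologicalSpace G, @IsTopologicalGroup G t _ ∧ @nhds G t 1 = F := by
  let n : G → Filter G := fun x => map (x * ·) F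
  let t : TopologicalSpace G := .mkOfNhds n
  have hn : ∀ x, 𝓝 x = n x := fun x => by
    refine TopologicalSpace.nhds_mkOfNhds n x (fun a => ?_) fun a s hs => ?_
    · simpa [n] using map_mono (m := (a * ·)) h1
    · have := hmul.eventually (show ∀ᶠ z in F, a * z ∈ s from hs)
      have := this.curry
      rw [eventually_map]
      filter_upwards [this] with y hy
      change ∀ᶠ z in F, a * y * z ∈ s
      simpa only [mul_assoc] using hy
  have hF : 𝓝 (1 : G) = F := by simp [hn, n]
  refine ⟨t, IsTopologicalGroup.of_nhds_one ?_ ?_ ?_ ?_, hF⟩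
  · rw [hF]; exact hmul
  · rw [hF]; exact hinv
  · intro x; rw [hF, hn]
  · intro x; rw [hF]; exact hconj x

end FilterTopology

/-! ### Two-sided completeness of c-compact groups -/

section Raikov

variable {G : Type u} [Group G] [TopologicalSpace G]

/-- A sequence that is Cauchy for the two-sided uniformity of the group, that is, for both the left
and the right uniformity. -/
def IsRaikovCauchySeq (x : ℕ → G) : Prop :=
  Tendsto (fun p : ℕ × ℕ => (x p.1)⁻¹ * x p.2) (atTop ×ˢ atTop) (𝓝 1) ∧
    Tendsto (fun p : ℕ × ℕ => x p.1 * (x p.2)⁻¹) (atTop ×ˢ atTop) (𝓝 1)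

theorem IsRaikovCauchySeq.inv {x : ℕ → G} (hx : IsRaikovCauchySeq x) : IsRaikovCauchySeq x⁻¹ :=
  ⟨by simpa using hx.2, by simpa using hx.1⟩

theorem isRaikovCauchySeq_const (g : G) : IsRaikovCauchySeq fun _ => g := by
  constructor <;> simp [tendsto_const_nhds]

variable [IsTopologicalGroup G]

/-- Conjugation by the terms of a two-sided Cauchy sequence `x` is equicontinuous at the identity:
for large `n` the element `x n` differs from a fixed `x N` by a small left factor. -/
theorem IsRaikovCauchySeq.tendsto_conj {x : ℕ → G} (hx : IsRaikovCauchySeq x) {ι : Type*}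
    {l : Filter ι} {y : ι → G} (hy : Tendsto y l (𝓝 1)) :
    Tendsto (fun p : ℕ × ι => x p.1 * y p.2 * (x p.1)⁻¹) (atTop ×ˢ l) (𝓝 1) := by
  intro U hU
  have h0 : Tendsto (fun q : G × G => q.1 * q.2 * q.1⁻¹) (𝓝 1 ×ˢ 𝓝 1) (𝓝 1) := by
    have h := (tendsto_fst (f := 𝓝 (1 : G)) (g := 𝓝 (1 : G))).mul tendsto_snd |>.mul tendsto_fst.inv
    simpa using h
  obtain ⟨V, hV, W, hW, hVW⟩ := mem_prod_iff.1 (h0 hU)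
  have h1 := hx.2.eventually hV
  rw [prod_atTop_atTop_eq, eventually_atTop] at h1
  obtain ⟨⟨N, N'⟩, hN⟩ := h1
  have h2 : Tendsto (fun i => x N' * y i * (x N')⁻¹) l (𝓝 1) := by
    simpa using (hy.const_mul (x N')).mul_const (x N')⁻¹
  rw [mem_map]
  filter_upwards [(eventually_ge_atTop N).prod_mk (h2.eventually hW)] with ⟨n, i⟩ ⟨hn, hi⟩
  have h3 := hVW (mk_mem_prod (hN (n, N') ⟨hn, le_rfl⟩) hi)
  simpa [mul_assoc] using h3

/-- The product of two-sided Cauchy sequences is Cauchy for the right uniformity; the statement for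
the left uniformity follows by inversion. -/
theorem IsRaikovCauchySeq.mul_aux {x y : ℕ → G} (hx : IsRaikovCauchySeq x)
    (hy : IsRaikovCauchySeq y) :
    Tendsto (fun p : ℕ × ℕ => (x * y) p.1 * ((x * y) p.2)⁻¹) (atTop ×ˢ atTop) (𝓝 1) := by
  have h1 := (hx.tendsto_conj hy.2).comp
    (show Tendsto (fun p : ℕ × ℕ => (p.1, p)) (atTop ×ˢ atTop) (atTop ×ˢ (atTop ×ˢ atTop)) from
      tendsto_fst.prodMk tendsto_id)
  simpa [Function.comp_def, mul_assoc] using h1.mul hx.2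

theorem IsRaikovCauchySeq.mul {x y : ℕ → G} (hx : IsRaikovCauchySeq x)
    (hy : IsRaikovCauchySeq y) : IsRaikovCauchySeq (x * y) :=
  ⟨by simpa using hy.inv.mul_aux hx.inv, hx.mul_aux hy⟩

variable (G) in
/-- The group of two-sided Cauchy sequences under pointwise multiplication. -/
def raikovCauchySubgroup : Subgroup (ℕ → G) where
  carrier := {x | IsRaikovCauchySeq x}
  mul_mem' := IsRaikovCauchySeq.mul
  one_mem' := isRaikovCauchySeq_const 1
  inv_mem' := IsRaikovCauchySeq.inv

variable (G) in
/-- The filter on the group of two-sided Cauchy sequences generated by the sets of sequences that are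
eventually in `U`, for `U` a neighbourhood of `1` in `G`. -/
def eventuallySmall : Filter (raikovCauchySubgroup G) :=
  (𝓝 1).lift' fun U => {x | ∀ᶠ n in atTop, x.1 n ∈ U}

theorem hasBasis_eventuallySmall : (eventuallySmall G).HasBasis (fun U => U ∈ 𝓝 (1 : G))
    fun U => {x | ∀ᶠ n in atTop, x.1 n ∈ U} :=
  (𝓝 (1 : G)).basis_sets.lift' fun _ _ h _ hx => hx.mono fun _ hn => h hn

theorem exists_groupTopology_raikovCauchySubgroup :
    ∃ t : TopologicalSpace (raikovCauchySubgroup G),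
      @IsTopologicalGroup _ t _ ∧ @nhds _ t 1 = eventuallySmall G := by
  have hb := hasBasis_eventuallySmall (G := G)
  refine exists_groupTopology_nhds_one_eq _ ?_ ?_ ?_ ?_
  · exact hb.ge_iff.2 fun U (hU : U ∈ 𝓝 (1 : G)) =>
      mem_pure.2 (Eventually.of_forall fun _ => mem_of_mem_nhds hU)
  · refine hb.tendsto_right_iff.2 fun U hU => ?_
    obtain ⟨V, hV, hVU⟩ := exists_nhds_one_split hU
    filter_upwards [prod_mem_prod (hb.mem_of_mem hV) (hb.mem_of_mem hV)] with p hp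
    filter_upwards [hp.1, hp.2] with n h1 h2 using hVU _ h1 _ h2
  · refine hb.tendsto_right_iff.2 fun U hU => ?_
    filter_upwards [hb.mem_of_mem (inv_mem_nhds_one G hU)] with x hx using hx
  · intro x
    refine hb.tendsto_right_iff.2 fun U hU => ?_
    obtain ⟨V, hV, W, hW, hVW⟩ := mem_prod_iff.1 (x.2.tendsto_conj tendsto_id hU)
    filter_upwards [hb.mem_of_mem hW] with y hy
    filter_upwards [hV, hy] with n h1 h2 using hVW (mk_mem_prod h1 h2)

/-- A c-compact group is sequentially complete. The sequential Raikov completion is the group of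
two-sided Cauchy sequences modulo inseparability. The constant sequences are dense in it and, by
c-compactness, closed. -/
theorem IsCCompactGroup.exists_tendsto_of_isRaikovCauchySeq (hG : IsCCompactGroup G)
    {x : ℕ → G} (hx : IsRaikovCauchySeq x) : ∃ g, Tendsto x atTop (𝓝 g) := by
  obtain ⟨t, ht, hn⟩ := exists_groupTopology_raikovCauchySubgroup (G := G)
  have hb := hasBasis_eventuallySmall (G := G)
  rw [← hn] at hb
  let c : G →* raikovCauchySubgroup G :=
    { toFun := fun g => ⟨fun _ => g, isRaikovCauchySeq_const g⟩
      map_one' := rfl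
      map_mul' := fun _ _ => rfl }
  have hc : Continuous c := by
    refine continuous_of_continuousAt_one c ?_
    rw [ContinuousAt, map_one]
    refine hb.tendsto_right_iff.2 fun U hU => ?_
    filter_upwards [hU] with g hg using .of_forall fun _ => hg
  let q : raikovCauchySubgroup G →* SeparationQuotient (raikovCauchySubgroup G) :=
    { toFun := SeparationQuotient.mk, map_one' := rfl, map_mul' := fun _ _ => rfl }
  have hcl := hG.isClosed_range (q.comp c) (SeparationQuotient.continuous_mk.comp hc)
  have hlim : Tendsto (fun N => c (x N)) atTop (𝓝 ⟨x, hx⟩) := by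
    have h1 : Tendsto (fun N => (⟨x, hx⟩ : raikovCauchySubgroup G)⁻¹ * c (x N)) atTop (𝓝 1) := by
      refine hb.tendsto_right_iff.2 fun U hU => ?_
      have h2 := (hx.1.comp tendsto_prod_swap).eventually hU
      exact h2.curry
    simpa using h1.const_mul ⟨x, hx⟩
  have hmem : SeparationQuotient.mk ⟨x, hx⟩ ∈ (q.comp c).range :=
    hcl.mem_of_tendsto ((SeparationQuotient.continuous_mk.tendsto _).comp hlim)
      (.of_forall fun N => ⟨x N, rfl⟩)
  obtain ⟨g, hg⟩ := hmem
  have hi : Inseparable (c g) ⟨x, hx⟩ := SeparationQuotient.mk_eq_mk.1 hg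
  -- Sequences inseparable from `1` are exactly those that converge to `1`.
  have h2 : Inseparable ((c g)⁻¹ * ⟨x, hx⟩) 1 := by
    simpa using (Inseparable.refl (c g)⁻¹).mul hi.symm
  have h3 : Tendsto (fun n => g⁻¹ * x n) atTop (𝓝 1) := by
    intro U hU
    have h4 := hb.mem_of_mem hU
    rw [← h2.nhds_eq] at h4
    have h5 : (c g)⁻¹ * ⟨x, hx⟩ ∈ {y : raikovCauchySubgroup G | ∀ᶠ n in atTop, y.1 n ∈ U} :=
      mem_of_mem_nhds h4
    exact h5
  refine ⟨g, ?_⟩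
  simpa using h3.const_mul g

theorem IsCCompactGroup.polishSpace [T2Space G] [SecondCountableTopology G]
    (hG : IsCCompactGroup G) : PolishSpace G := by
  have hc : (𝓝 (1 : G)).IsCountablyGenerated := inferInstance
  let U₀ : UniformSpace G :=
    IsTopologicalGroup.leftUniformSpace G ⊓ IsTopologicalGroup.rightUniformSpace G
  have hU : 𝓤[U₀] = comap (fun p : G × G => p.1⁻¹ * p.2) (𝓝 1) ⊓
      comap (fun p : G × G => p.2 * p.1⁻¹) (𝓝 1) := inf_uniformity
  have htop : ‹TopologicalSpace G› = U₀.toTopologicalSpace :=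
    (UniformSpace.toTopologicalSpace_inf.trans (inf_idem ‹TopologicalSpace G›)).symm
  let U : UniformSpace G := U₀.replaceTopology htop
  change 𝓤 G = _ at hU
  have : (𝓤 G).IsCountablyGenerated := by
    rw [hU]
    exact @Inf.isCountablyGenerated _ _ _ (comap.isCountablyGenerated _ _)
      (comap.isCountablyGenerated _ _)
  have : CompleteSpace G := by
    refine UniformSpace.complete_of_cauchySeq_tendsto fun x hx => ?_
    rw [cauchySeq_iff_tendsto, ← prod_atTop_atTop_eq, hU, tendsto_inf, tendsto_comap_iff,
      tendsto_comap_iff] at hx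
    exact hG.exists_tendsto_of_isRaikovCauchySeq ⟨hx.1, hx.2.comp tendsto_prod_swap⟩
  infer_instance

end Raikov

/-! ### Second countable c-compact MAP groups are compact -/

section CompactImage

/-- A continuous bijective homomorphism from a Polish group onto a compact group is open. Borel sets
have Borel images by the Lusin-Souslin theorem, which allows Steinhaus' theorem to replace the
Baire category argument. -/
theorem isInducing_of_bijective_of_polishSpace {G K : Type*} [Group G] [TopologicalSpace G]
    [IsTopologicalGroup G] [PolishSpace G] [Group K] [TopologicalSpace K] [IsTopologicalGroup K]
    [T2Space K] [CompactSpace K] (m : G →* K) (hm : Continuous m) (hb : Function.Bijective m) :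
    IsInducing m := by
  borelize G K
  have hme := hm.measurableEmbedding hb.1
  let μ : Measure K := Measure.haarMeasure ⊤
  rw [IsTopologicalGroup.isInducing_iff_nhds_one]
  refine le_antisymm (by simpa using (hm.tendsto 1).le_comap) fun U hU => ?_
  obtain ⟨V, hV, hVo, hVU⟩ : ∃ V ∈ 𝓝 (1 : G), IsOpen V ∧ V / V ⊆ U := by
    obtain ⟨V, hV, h⟩ := exists_nhds_split_inv hU
    refine ⟨interior V, interior_mem_nhds.2 hV, isOpen_interior, ?_⟩
    rintro _ ⟨a, ha, b, hb, rfl⟩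
    exact h a (interior_subset ha) b (interior_subset hb)
  obtain ⟨D, hDc, hD⟩ := TopologicalSpace.exists_countable_dense G
  -- Countably many translates of the image of `V` cover `K`, so this image is not a null set.
  have hcov : (⋃ d ∈ D, m d • m '' V) = univ := by
    refine eq_univ_of_forall fun k => ?_
    obtain ⟨g, rfl⟩ := hb.2 k
    obtain ⟨d, hdD, hd⟩ := hD.exists_mem_open (hVo.preimage (continuous_inv.mul continuous_const))
      ⟨g, show g⁻¹ * g ∈ V by simpa using mem_of_mem_nhds hV⟩
    exact mem_biUnion hdD ⟨m (d⁻¹ * g), mem_image_of_mem m hd, by simp⟩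
  have hpos : 0 < μ (m '' V) := by
    by_contra! h0
    have h : μ univ ≤ 0 := by
      rw [← hcov]
      refine (measure_biUnion_null_iff hDc).2 (fun d _ => ?_) |>.le
      rw [measure_smul]
      exact le_antisymm h0 zero_le
    exact (isOpen_univ.measure_pos μ univ_nonempty).not_ge h
  have hst := Measure.div_mem_nhds_one_of_haar_pos_ne_top μ _
    (hme.measurableSet_image.2 hVo.measurableSet) hpos (measure_ne_top _ _)
  refine ⟨_, hst, ?_⟩
  rintro g ⟨_, ⟨a, ha, rfl⟩, _, ⟨b, hb', rfl⟩, hab⟩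
  have : g = a / b := hb.1 (by simpa using hab.symm)
  exact hVU (this ▸ div_mem_div ha hb')

theorem IsCCompactGroup.compactSpace_of_isMaximallyAlmostPeriodic {G : Type u} [Group G]
    [TopologicalSpace G] [IsTopologicalGroup G] [T2Space G] [SecondCountableTopology G]
    (hG : IsCCompactGroup G) (h : IsMaximallyAlmostPeriodic G) : CompactSpace G := by
  obtain ⟨K, _, _, _, _, _, m, hm, hinj⟩ := h
  have := hG.polishSpace
  have hcl := hG.isClosed_range m hm
  have : CompactSpace m.range := isCompact_iff_compactSpace.1 hcl.isCompact
  have hi := isInducing_of_bijective_of_polishSpace m.rangeRestrict (hm.subtype_mk _)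
    ⟨fun a b hab => hinj (congrArg Subtype.val hab), m.rangeRestrict_surjective⟩
  rw [← isCompact_univ_iff, hi.isCompact_iff, image_univ,
    m.rangeRestrict_surjective.range_eq]
  exact isCompact_univ

end CompactImage

/-! ### Finite-dimensional unitary representations of compact groups -/

section PeterWeyl

variable {G : Type*} [Group G] [TopologicalSpace G]
  {E : Type*} [NormedAddCommGroup E] [InnerProductSpace ℂ E]

/-- The matrix form, in an orthonormal basis, of a finite-dimensional subrepresentation. -/
theorem exists_unitary_matrix_hom_of_invariant (π : G →* (E ≃ₗᵢ[ℂ] E))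
    (hπ : ∀ v, Continuous fun x => π x v) (W : Submodule ℂ E) [FiniteDimensional ℂ W]
    (hW : ∀ x, ∀ v ∈ W, π x v ∈ W) :
    ∃ (n : ℕ) (ρ : G →* Matrix.unitaryGroup (Fin n) ℂ), Continuous ρ ∧
      ∀ x, ρ x = 1 → ∀ v ∈ W, π x v = v := by
  let b := stdOrthonormalBasis ℂ W
  let A : G → Matrix (Fin (Module.finrank ℂ W)) (Fin (Module.finrank ℂ W)) ℂ :=
    fun x => .of fun i j => inner ℂ (b i : E) (π x (b j))
  have hexp : ∀ v ∈ W, v = ∑ k, inner ℂ (b k : E) v • (b k : E) := by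
    intro v hv
    have h := congrArg (Subtype.val) (b.sum_repr' ⟨v, hv⟩)
    simpa using h.symm
  have hone : A 1 = 1 := by
    ext i j
    have h := orthonormal_iff_ite.1 b.orthonormal i j
    simpa [A, Matrix.one_apply] using h
  have hmul : ∀ x y, A (x * y) = A x * A y := by
    intro x y
    ext i j
    have h := congrArg (fun v => inner ℂ (b i : E) (π x v)) (hexp _ (hW y _ (b j).2))
    simp only [map_sum, map_smul, inner_sum, inner_smul_right] at h
    simp only [A, Matrix.of_apply, Matrix.mul_apply, map_mul, LinearIsometryEquiv.coe_mul,
      Function.comp_apply]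
    rw [h]
    exact Finset.sum_congr rfl fun k _ => mul_comm _ _
  have hstar : ∀ x, star (A x) = A x⁻¹ := by
    intro x
    ext i j
    simp only [A, Matrix.star_apply, Matrix.of_apply, RCLike.star_def, inner_conj_symm]
    have h := (π x⁻¹).inner_map_map (π x (b i)) (b j : E)
    rw [← h, show π x⁻¹ (π x (b i)) = b i by rw [map_inv]; exact (π x).symm_apply_apply _]
  let ρ : G →* Matrix.unitaryGroup (Fin (Module.finrank ℂ W)) ℂ :=
    { toFun := fun x => ⟨A x, by
        rw [Matrix.mem_unitaryGroup_iff, hstar, ← hmul, mul_inv_cancel, hone]⟩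
      map_one' := Subtype.ext hone
      map_mul' := fun x y => Subtype.ext (hmul x y) }
  refine ⟨_, ρ, ?_, fun x hx v hv => ?_⟩
  · refine Continuous.subtype_mk (continuous_matrix fun i j => ?_) _
    exact continuous_const.inner (hπ _)
  · have hA : A x = 1 := congrArg Subtype.val hx
    have hb : ∀ j, π x (b j) = b j := by
      intro j
      rw [hexp _ (hW x _ (b j).2)]
      have : ∀ k, inner ℂ (b k : E) (π x (b j)) = (1 : Matrix _ _ ℂ) k j := by
        intro k; rw [← hA]; rfl
      simp [this, Matrix.one_apply]
    conv_lhs => rw [hexp v hv]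
    conv_rhs => rw [hexp v hv]
    simp [hb]

theorem continuous_rankOne_orbit {π : G →* (E ≃ₗᵢ[ℂ] E)}
    (hπ : ∀ v, Continuous fun x => π x v) (w : E) :
    Continuous fun x => rankOne ℂ (π x w) (π x w) := by
  have h : Continuous fun x => ContinuousLinearMap.smulRightL ℂ E E (innerSL ℂ (π x w)) :=
    (ContinuousLinearMap.smulRightL ℂ E E).continuous.comp ((innerSL ℂ).continuous.comp (hπ w))
  exact h.clm_apply (hπ w)

theorem integrable_of_continuous_of_compactSpace {X F : Type*} [TopologicalSpace X]
    [CompactSpace X] [MeasurableSpace X] [OpensMeasurableSpace X] {μ : Measure X}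
    [IsFiniteMeasureOnCompacts μ] [NormedAddCommGroup F] {f : X → F} (hf : Continuous f) :
    Integrable f μ :=
  hf.integrable_of_hasCompactSupport (HasCompactSupport.of_compactSpace f)

variable [CompactSpace G] [MeasurableSpace G] [BorelSpace G]

/-- The average over the orbit of `w` of the rank one operators `v ↦ ⟪π x w, v⟫ • π x w`. -/
noncomputable def orbitAverage (μ : Measure G) (π : G →* (E ≃ₗᵢ[ℂ] E)) (w : E) : E →L[ℂ] E :=
  ∫ x, rankOne ℂ (π x w) (π x w) ∂μ

variable {μ : Measure G} [IsProbabilityMeasure μ] {π : G →* (E ≃ₗᵢ[ℂ] E)}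

theorem orbitAverage_apply (hπ : ∀ v, Continuous fun x => π x v) (w v : E) :
    orbitAverage μ π w v = ∫ x, inner ℂ (π x w) v • π x w ∂μ := by
  rw [orbitAverage, ContinuousLinearMap.integral_apply
    (integrable_of_continuous_of_compactSpace (continuous_rankOne_orbit hπ w))]
  rfl

theorem isCompactOperator_orbitAverage [CompleteSpace E]
    (hπ : ∀ v, Continuous fun x => π x v) (w : E) :
    IsCompactOperator (orbitAverage μ π w) := by
  refine Convex.integral_mem (s := (compactOperator (RingHom.id ℂ) E E : Set (E →L[ℂ] E)))
    (((compactOperator (RingHom.id ℂ) E E).restrictScalars ℝ).convex)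
    isClosed_setOfPred_isCompactOperator (ae_of_all _ fun x => ?_)
    (integrable_of_continuous_of_compactSpace (continuous_rankOne_orbit hπ w))
  have h : IsCompactOperator (innerSL ℂ (π x w)) :=
    isCompactOperator_of_locallyCompactSpace_dom (innerSL ℂ (π x w))
  exact h.continuous_comp (ContinuousLinearMap.toSpanSingleton ℂ (π x w)).continuous

theorem inner_orbitAverage [CompleteSpace E] (hπ : ∀ v, Continuous fun x => π x v) (w u v : E) :
    inner ℂ u (orbitAverage μ π w v) = ∫ x, inner ℂ (π x w) v * inner ℂ u (π x w) ∂μ := by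
  rw [orbitAverage_apply hπ, ← integral_inner]
  · simp only [inner_smul_right]
  · exact integrable_of_continuous_of_compactSpace
      (((hπ w).inner continuous_const).smul (hπ w))

theorem isSymmetric_orbitAverage [CompleteSpace E] (hπ : ∀ v, Continuous fun x => π x v) (w : E) :
    (orbitAverage μ π w).IsSymmetric := by
  intro u v
  change inner ℂ (orbitAverage μ π w u) v = inner ℂ u (orbitAverage μ π w v)
  rw [← inner_conj_symm, inner_orbitAverage hπ, inner_orbitAverage hπ, ← integral_conj]
  congr 1
  ext x
  simp [mul_comm]

theorem orbitAverage_comm [IsTopologicalGroup G]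
    [μ.IsMulLeftInvariant] (hπ : ∀ v, Continuous fun x => π x v)
    (w v : E) (h : G) : orbitAverage μ π w (π h v) = π h (orbitAverage μ π w v) := by
  rw [orbitAverage_apply hπ, orbitAverage_apply hπ,
    ← integral_mul_left_eq_self (fun x => inner ℂ (π x w) (π h v) • π x w) h]
  refine Eq.trans ?_ ((π h).toContinuousLinearEquiv.integral_comp_comm _)
  simp

/-- `⟪v, orbitAverage μ π w v⟫` is the integral of the continuous function `‖⟪π x w, v⟫‖ ^ 2`. -/
theorem inner_eq_zero_of_orbitAverage_eq_zero [CompleteSpace E] [μ.IsOpenPosMeasure]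
    (hπ : ∀ v, Continuous fun x => π x v) {w v : E} (h : orbitAverage μ π w v = 0) :
    inner ℂ w v = 0 := by
  have h1 := inner_orbitAverage (μ := μ) hπ w v v
  have hc : Continuous fun x => ‖inner ℂ (π x w) v‖ ^ 2 :=
    ((hπ w).inner continuous_const).norm.pow 2
  have h2 : ∫ x, ‖inner ℂ (π x w) v‖ ^ 2 ∂μ = 0 := by
    rw [h, inner_zero_right] at h1
    have : ∀ x, inner ℂ (π x w) v * inner ℂ v (π x w) = ((‖inner ℂ (π x w) v‖ ^ 2 : ℝ) : ℂ) := by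
      intro x
      rw [← inner_conj_symm v, Complex.mul_conj, Complex.normSq_eq_norm_sq]
    simp only [this] at h1
    rw [integral_complex_ofReal] at h1
    exact_mod_cast h1.symm
  rw [integral_eq_zero_iff_of_nonneg (fun x => sq_nonneg _)
    (integrable_of_continuous_of_compactSpace hc)] at h2
  have h3 := congrFun ((hc.ae_eq_iff_eq μ continuous_const).1 h2) 1
  have h4 : ‖inner ℂ (π 1 w) v‖ ^ 2 = 0 := h3
  simpa using h4

/-- Put `w = π g v - v` with `π g v ≠ v`. If `g` acted trivially on all finite-dimensional
subrepresentations, then `w` would be orthogonal to every eigenspace of `orbitAverage μ π w` with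
nonzero eigenvalue, so that `orbitAverage μ π w w = 0` and `w = 0`. -/
theorem exists_unitary_matrix_hom_ne_one [IsTopologicalGroup G] [CompleteSpace E]
    [μ.IsMulLeftInvariant] [μ.IsOpenPosMeasure]
    (hπ : ∀ v, Continuous fun x => π x v) {g : G} (hg : π g ≠ 1) :
    ∃ (n : ℕ) (ρ : G →* Matrix.unitaryGroup (Fin n) ℂ), Continuous ρ ∧ ρ g ≠ 1 := by
  by_contra! H
  obtain ⟨v, hv⟩ : ∃ v, π g v ≠ v := by
    by_contra! h
    exact hg (LinearIsometryEquiv.ext h)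
  let w := π g v - v
  let T := orbitAverage μ π w
  have hTc : IsCompactOperator T := isCompactOperator_orbitAverage hπ w
  have hTs : T.IsSymmetric := isSymmetric_orbitAverage hπ w
  have key : T w ∈ (⨆ c, Module.End.eigenspace (T : Module.End ℂ E) c)ᗮ := by
    rw [← Submodule.iInf_orthogonal, Submodule.mem_iInf]
    intro c u hu
    have huc : T u = c • u := Module.End.mem_eigenspace_iff.1 hu
    have hTu : inner ℂ u (T w) = inner ℂ (T u) w := (hTs u w).symm
    -- The eigenspace of `0` needs no representation: `T w` is orthogonal to the kernel of `T`.
    rw [hTu, huc, inner_smul_left]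
    rcases eq_or_ne c 0 with rfl | hc
    · simp
    have : FiniteDimensional ℂ (Module.End.eigenspace (T : Module.End ℂ E) c) :=
      ContinuousLinearMap.finite_dimensional_eigenspace hTc c hc
    obtain ⟨n, ρ, hρ, hρ'⟩ := exists_unitary_matrix_hom_of_invariant π hπ
      (Module.End.eigenspace (T : Module.End ℂ E) c) fun x v hv => by
        rw [Module.End.mem_eigenspace_iff] at hv ⊢
        have hv' : T v = c • v := hv
        have := orbitAverage_comm (μ := μ) hπ w v x
        exact this.trans (by rw [show orbitAverage μ π w v = c • v from hv', map_smul])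
    have hgu : π g u = u := hρ' g (H n ρ hρ) u hu
    have : inner ℂ u w = 0 := by
      rw [inner_sub_right, sub_eq_zero]
      conv_lhs => rw [← hgu]
      exact (π g).inner_map_map u v
    rw [this, mul_zero]
  rw [ContinuousLinearMap.orthogonalComplement_iSup_eigenspaces_eq_bot hTc hTs,
    Submodule.mem_bot] at key
  have := inner_eq_zero_of_orbitAverage_eq_zero hπ key
  rw [inner_self_eq_zero] at this
  exact hv (sub_eq_zero.1 this)

section L2

variable {G : Type*} [Group G] [TopologicalSpace G] [IsTopologicalGroup G] [MeasurableSpace G]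
  [BorelSpace G]

open DomMulAct in
/-- The left regular representation `(x • f) y = f (x⁻¹ * y)` on `L²(G, μ)`. -/
noncomputable def leftRegularRep (μ : Measure G) [μ.IsMulLeftInvariant] :
    G →* (Lp ℂ 2 μ ≃ₗᵢ[ℂ] Lp ℂ 2 μ) where
  toFun x :=
    { toFun := fun f => mk x⁻¹ • f
      invFun := fun f => mk x • f
      map_add' := smul_Lp_add _
      map_smul' := fun c f => smul_comm _ _ _
      left_inv := fun f => by change mk x • mk x⁻¹ • f = f; rw [smul_smul, ← mk_mul]; simp
      right_inv := fun f => by change mk x⁻¹ • mk x • f = f; rw [smul_smul, ← mk_mul]; simp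
      norm_map' := norm_smul_Lp _ }
  map_one' := by ext1 f; change mk (1 : G)⁻¹ • f = f; simp
  map_mul' x y := by
    ext1 f
    change mk (x * y)⁻¹ • f = mk x⁻¹ • mk y⁻¹ • f
    rw [smul_smul, ← mk_mul, mul_inv_rev]

theorem leftRegularRep_ne_one [T2Space G] (μ : Measure G) [μ.IsMulLeftInvariant]
    [μ.IsOpenPosMeasure] [IsFiniteMeasure μ] {g : G} (hg : g ≠ 1) : leftRegularRep μ g ≠ 1 := by
  obtain ⟨A, B, hA, hB, hgA, h1B, hAB⟩ := t2_separation hg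
  -- `U` is a neighbourhood of `1` disjoint from its left translate by `g`.
  let U := B ∩ (g * ·) ⁻¹' A
  have hU : IsOpen U := hB.inter (hA.preimage (continuous_const_mul g))
  intro h
  have h1 := LinearIsometryEquiv.congr_fun h
    (indicatorConstLp 2 hU.measurableSet (measure_ne_top μ U) (1 : ℂ))
  change DomMulAct.mk g⁻¹ • indicatorConstLp 2 hU.measurableSet (measure_ne_top μ U) (1 : ℂ) =
    indicatorConstLp 2 hU.measurableSet (measure_ne_top μ U) (1 : ℂ) at h1
  rw [DomMulAct.mk_smul_indicatorConstLp] at h1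
  have h2 := indicatorConstLp_inj _ _ _ _ one_ne_zero |>.1 h1
  have h3 : U =ᵐ[μ] (∅ : Set G) := by
    filter_upwards [h2] with x hx
    refine eq_false fun hxU => ?_
    have hx' : x ∈ (g⁻¹ • ·) ⁻¹' U := hx.mpr hxU
    have hxA : g * (g⁻¹ * x) ∈ A := hx'.2
    rw [mul_inv_cancel_left] at hxA
    exact Set.disjoint_left.1 hAB hxA hxU.1
  exact (hU.measure_ne_zero μ ⟨1, h1B, by simpa using hgA⟩) (ae_eq_empty.1 h3)

end L2

/-- The finite-dimensional unitary representations of a compact group separate its points. -/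
theorem exists_unitary_matrix_hom_ne_one_of_compactSpace {G : Type*} [Group G]
    [TopologicalSpace G] [IsTopologicalGroup G] [T2Space G] [CompactSpace G] {g : G}
    (hg : g ≠ 1) :
    ∃ (n : ℕ) (ρ : G →* Matrix.unitaryGroup (Fin n) ℂ), Continuous ρ ∧ ρ g ≠ 1 := by
  borelize G
  let μ : Measure G := Measure.haarMeasure ⊤
  have : IsProbabilityMeasure μ := ⟨Measure.haarMeasure_self⟩
  refine exists_unitary_matrix_hom_ne_one (μ := μ) (π := leftRegularRep μ) (fun v => ?_)
    (leftRegularRep_ne_one μ hg)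
  change Continuous fun x : G => DomMulAct.mk x⁻¹ • v
  have hmk : Continuous (DomMulAct.mk : G → Gᵈᵐᵃ) := DomMulAct.continuous_mk
  have : Fact ((2 : ENNReal) ≠ ⊤) := ⟨by simp⟩
  exact (hmk.comp continuous_inv).smul continuous_const

end PeterWeyl

/-! ### ω-narrow groups and homomorphisms onto second countable groups -/

section Guran

variable {G : Type u} [Group G] [TopologicalSpace G]

variable (G) in
/-- A topological group is ω-narrow if it is covered by countably many translates of any neighbourhood
of the identity. -/
def IsOmegaNarrow : Prop :=
  ∀ U ∈ 𝓝 (1 : G), ∃ A : Set G, A.Countable ∧ A * U = univ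

theorem exists_seq_inv_mul_notMem_of_not_isOmegaNarrow (h : ¬ IsOmegaNarrow G) :
    ∃ U ∈ 𝓝 (1 : G), ∃ x : ℕ → G, ∀ m n, m < n → (x m)⁻¹ * x n ∉ U := by
  unfold IsOmegaNarrow at h
  push Not at h
  obtain ⟨U, hU, hA⟩ := h
  obtain ⟨x, -, hx⟩ := exists_seq_of_forall_finset_exists (fun _ : G => True)
    (fun a b => a⁻¹ * b ∉ U) fun s _ => by
      obtain ⟨y, hy⟩ := (ne_univ_iff_exists_notMem _).1 (hA s s.countable_toSet)
      exact ⟨y, trivial, fun a ha hay => hy ⟨a, ha, _, hay, by simp⟩⟩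
  exact ⟨U, hU, x, hx⟩

variable [IsTopologicalGroup G]

theorem isOmegaNarrow_of_separableSpace [TopologicalSpace.SeparableSpace G] :
    IsOmegaNarrow G := by
  intro U hU
  obtain ⟨D, hDc, hD⟩ := TopologicalSpace.exists_countable_dense G
  refine ⟨D, hDc, eq_univ_of_forall fun g => ?_⟩
  have h : ∀ᶠ x in 𝓝 g, x⁻¹ * g ∈ U := by
    have : Tendsto (fun x => x⁻¹ * g) (𝓝 g) (𝓝 1) := by
      simpa using (tendsto_inv g).mul_const g
    exact this.eventually hU
  obtain ⟨x, hx, hxD⟩ := mem_closure_iff_nhds.1 (hD g) _ h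
  exact ⟨x, hxD, _, hx, by simp⟩

theorem IsOmegaNarrow.separableSpace [FirstCountableTopology G] (hG : IsOmegaNarrow G) :
    TopologicalSpace.SeparableSpace G := by
  obtain ⟨b, hb⟩ := (𝓝 (1 : G)).exists_antitone_basis
  choose A hAc hA using fun n => hG _ (inv_mem_nhds_one G (hb.mem n))
  refine ⟨⋃ n, A n, countable_iUnion hAc, fun g => ?_⟩
  rw [mem_closure_iff_nhds]
  intro s hs
  have h : (fun x => g * x) ⁻¹' s ∈ 𝓝 (1 : G) :=
    (continuous_const_mul g).continuousAt.preimage_mem_nhds (by simpa using hs)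
  obtain ⟨n, -, hn⟩ := hb.1.mem_iff.1 h
  obtain ⟨a, ha, u, hu, hau⟩ : g ∈ A n * (b n)⁻¹ := hA n ▸ mem_univ g
  refine ⟨a, ?_, mem_iUnion.2 ⟨n, ha⟩⟩
  have : g * u⁻¹ ∈ s := hn hu
  rwa [← hau, mul_inv_cancel_right] at this

theorem IsOmegaNarrow.secondCountableTopology [FirstCountableTopology G]
    (hG : IsOmegaNarrow G) : SecondCountableTopology G := by
  have := hG.separableSpace
  have hc : (𝓝 (1 : G)).IsCountablyGenerated := inferInstance
  let := IsTopologicalGroup.rightUniformSpace G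
  have : (𝓤 G).IsCountablyGenerated := comap.isCountablyGenerated _ _
  exact UniformSpace.secondCountable_of_separable G

/-- ω-narrow groups are ω-balanced: up to a small factor, which is absorbed into `U`, only the
countably many conjugations by elements of a set `A` with `A * W = univ` matter. -/
theorem IsOmegaNarrow.exists_countable_conj (hG : IsOmegaNarrow G) {U : Set G}
    (hU : U ∈ 𝓝 1) : ∃ F : Set (Set G), F.Countable ∧ (∀ V ∈ F, V ∈ 𝓝 1) ∧
      ∀ x : G, ∃ V ∈ F, ∀ v ∈ V, x * v * x⁻¹ ∈ U := by
  have h0 : Tendsto (fun q : G × G => q.1⁻¹ * q.2 * q.1) (𝓝 1 ×ˢ 𝓝 1) (𝓝 1) := by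
    have h := (tendsto_fst (f := 𝓝 (1 : G)) (g := 𝓝 (1 : G))).inv.mul tendsto_snd |>.mul tendsto_fst
    simpa using h
  obtain ⟨W, hW, W', hW', hWW⟩ := mem_prod_iff.1 (h0 hU)
  obtain ⟨A, hAc, hA⟩ := hG W hW
  refine ⟨(fun a => {v | a⁻¹ * v * a ∈ W'}) '' A, hAc.image _, ?_, fun x => ?_⟩
  · rintro _ ⟨a, -, rfl⟩
    have : Tendsto (fun v => a⁻¹ * v * a) (𝓝 1) (𝓝 1) := by
      simpa using ((tendsto_id (x := 𝓝 (1 : G))).const_mul a⁻¹).mul_const a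
    exact this hW'
  · obtain ⟨a, ha, w, hw, haw⟩ : x⁻¹ ∈ A * W := hA ▸ mem_univ _
    refine ⟨_, mem_image_of_mem _ ha, fun v hv => ?_⟩
    have := hWW (mk_mem_prod hw hv)
    rw [← inv_inv x, ← haw]
    simpa [mul_assoc] using this

/-- For every `U` there is a countable family of neighbourhoods witnessing the continuity of
multiplication, inversion and all conjugations with respect to `U`. -/
theorem IsOmegaNarrow.exists_countable_refinement (hG : IsOmegaNarrow G) {U : Set G}
    (hU : U ∈ 𝓝 1) : ∃ F : Set (Set G), F.Countable ∧ (∀ V ∈ F, V ∈ 𝓝 1) ∧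
      (∀ x : G, ∃ V ∈ F, ∀ v ∈ V, x * v * x⁻¹ ∈ U) ∧
      (∃ V ∈ F, ∀ v ∈ V, ∀ w ∈ V, v * w ∈ U) ∧ ∃ V ∈ F, ∀ v ∈ V, v⁻¹ ∈ U := by
  obtain ⟨F, hFc, hF, hFU⟩ := hG.exists_countable_conj hU
  obtain ⟨V, hV, hVU⟩ := exists_nhds_one_split hU
  refine ⟨insert V (insert U⁻¹ F), (hFc.insert _).insert _, ?_, fun x => ?_,
    ⟨V, by simp, hVU⟩, ⟨U⁻¹, by simp, fun v hv => hv⟩⟩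
  · rintro _ (rfl | rfl | h)
    exacts [hV, inv_mem_nhds_one G hU, hF _ h]
  · obtain ⟨W, hW, h⟩ := hFU x
    exact ⟨W, by simp [hW], h⟩

/-- Closing `{U}` under the countable refinements yields a countable family of neighbourhoods, which
generates the neighbourhood filter of the identity for a coarser group topology. -/
theorem IsOmegaNarrow.exists_firstCountable_groupTopology (hG : IsOmegaNarrow G) {U : Set G}
    (hU : U ∈ 𝓝 1) : ∃ F : Filter G, F.IsCountablyGenerated ∧ 𝓝 1 ≤ F ∧ U ∈ F ∧
      ∃ t : TopologicalSpace G, @IsTopologicalGroup G t _ ∧ @nhds G t 1 = F := by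
  choose! R hRc hR hconj hmul hinv using
    fun (V : Set G) (hV : V ∈ 𝓝 1) => hG.exists_countable_refinement hV
  let 𝒱 : ℕ → Set (Set G) := fun n => Nat.rec {U} (fun _ S => ⋃ V ∈ S, R V) n
  have hsucc : ∀ n, 𝒱 (n + 1) = ⋃ V ∈ 𝒱 n, R V := fun n => rfl
  have hnhds : ∀ n, ∀ V ∈ 𝒱 n, V ∈ 𝓝 1 := by
    intro n
    induction n with
    | zero => exact fun V hV => (show V = U from hV) ▸ hU
    | succ n ih =>
      intro V hV
      rw [hsucc, mem_iUnion₂] at hV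
      obtain ⟨W, hW, hV⟩ := hV
      exact hR W (ih W hW) V hV
  have hcount : ∀ n, (𝒱 n).Countable := by
    intro n
    induction n with
    | zero => exact countable_singleton U
    | succ n ih =>
      rw [hsucc]
      exact ih.biUnion fun V hV => hRc V (hnhds n V hV)
  let 𝒲 := ⋃ n, 𝒱 n
  have h𝒲 : ∀ V ∈ 𝒲, V ∈ 𝓝 1 := fun V hV => by
    obtain ⟨n, hn⟩ := mem_iUnion.1 hV
    exact hnhds n V hn
  have hR𝒲 : ∀ V ∈ 𝒲, R V ⊆ 𝒲 := fun V hV W hW => by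
    obtain ⟨n, hn⟩ := mem_iUnion.1 hV
    exact mem_iUnion.2 ⟨n + 1, mem_biUnion hn hW⟩
  let F : Filter G := generate 𝒲
  have hle : 𝓝 1 ≤ F := le_generate_iff.2 h𝒲
  have hmem : ∀ V ∈ 𝒲, V ∈ F := fun V hV => mem_generate_of_mem hV
  have htends : ∀ {α : Type u} {l : Filter α} {f : α → G},
      (∀ V ∈ 𝒲, f ⁻¹' V ∈ l) → Tendsto f l F := fun h => le_generate_iff.2 h
  refine ⟨F, ⟨𝒲, countable_iUnion hcount, rfl⟩, hle,
    hmem U (mem_iUnion.2 ⟨0, rfl⟩), exists_groupTopology_nhds_one_eq F ((pure_le_nhds 1).trans hle)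
    (htends fun V hV => ?_) (htends fun V hV => ?_) fun x => htends fun V hV => ?_⟩
  · obtain ⟨W, hW, h⟩ := hmul V (h𝒲 V hV)
    filter_upwards [prod_mem_prod (hmem W (hR𝒲 V hV hW)) (hmem W (hR𝒲 V hV hW))] with p hp
    exact h _ hp.1 _ hp.2
  · obtain ⟨W, hW, h⟩ := hinv V (h𝒲 V hV)
    exact mem_of_superset (hmem W (hR𝒲 V hV hW)) h
  · obtain ⟨W, hW, h⟩ := hconj V (h𝒲 V hV) x
    exact mem_of_superset (hmem W (hR𝒲 V hV hW)) h

/-- The homomorphism is the Hausdorff quotient of `G`, whose topology may fail to be Hausdorff. -/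
theorem IsOmegaNarrow.exists_hom_secondCountable_of_firstCountable [FirstCountableTopology G]
    (hG : IsOmegaNarrow G) : ∃ (H : Type u) (_ : Group H) (_ : TopologicalSpace H)
      (_ : IsTopologicalGroup H) (_ : T2Space H) (_ : SecondCountableTopology H) (f : G →* H),
      Function.Surjective f ∧ comap f (𝓝 1) = 𝓝 1 := by
  have := hG.secondCountableTopology
  let q : G →* SeparationQuotient G :=
    { toFun := SeparationQuotient.mk, map_one' := rfl, map_mul' := fun _ _ => rfl }
  refine ⟨SeparationQuotient G, inferInstance, inferInstance, inferInstance, inferInstance,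
    ?_, q, SeparationQuotient.surjective_mk, ?_⟩
  · exact SeparationQuotient.isQuotientMap_mk.secondCountableTopology
      SeparationQuotient.isOpenMap_mk
  · exact SeparationQuotient.comap_mk_nhds_mk

/-- Guran's theorem: the neighbourhoods of the identity in an ω-narrow group are detected by
homomorphisms onto second countable groups. -/
theorem IsOmegaNarrow.exists_hom_secondCountable (hG : IsOmegaNarrow G) {U : Set G}
    (hU : U ∈ 𝓝 1) : ∃ (H : Type u) (_ : Group H) (_ : TopologicalSpace H)
      (_ : IsTopologicalGroup H) (_ : T2Space H) (_ : SecondCountableTopology H) (f : G →* H),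
      Continuous f ∧ Function.Surjective f ∧ ∃ V ∈ 𝓝 (1 : H), f ⁻¹' V ⊆ U := by
  obtain ⟨F, hFc, hF, hUF, ht⟩ := hG.exists_firstCountable_groupTopology hU
  obtain ⟨H, _, _, _, _, _, f, hf, hf1⟩ : ∃ (H : Type u) (_ : Group H) (_ : TopologicalSpace H)
      (_ : IsTopologicalGroup H) (_ : T2Space H) (_ : SecondCountableTopology H) (f : G →* H),
      Function.Surjective f ∧ comap f (𝓝 1) = F := by
    obtain ⟨t', ht', hn⟩ := ht
    have hfirst : @FirstCountableTopology G t' := by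
      refine ⟨fun x => ?_⟩
      have : (𝓝 (1 : G)).IsCountablyGenerated := hn ▸ hFc
      rw [← map_mul_left_nhds_one]
      infer_instance
    rw [← hn]
    exact @IsOmegaNarrow.exists_hom_secondCountable_of_firstCountable G _ t' ht' hfirst
      fun V hV => hG V (hF (hn ▸ hV))
  refine ⟨H, _, _, ‹_›, ‹_›, ‹_›, f, continuous_of_tendsto_nhds_one f ?_, hf, ?_⟩
  · exact (tendsto_iff_comap.2 hf1.ge).mono_left hF
  · rwa [← hf1] at hUF

end Guran

/-! ### Reduction to second countable groups -/

section Reduction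

variable {G : Type u} [Group G] [TopologicalSpace G] [IsTopologicalGroup G]

theorem IsCCompactGroup.compactSpace_of_isOmegaNarrow
    (H : ∀ (Q : Type u) [Group Q] [TopologicalSpace Q] [IsTopologicalGroup Q] [T2Space Q]
      [SecondCountableTopology Q], IsCCompactGroup Q → CompactSpace Q)
    (hG : IsCCompactGroup G) (hω : IsOmegaNarrow G) : CompactSpace G := by
  choose Q _ _ _ _ _ f hf hs V hV hVU using
    fun U : {U : Set G // U ∈ 𝓝 1} => hω.exists_hom_secondCountable U.2
  have hQ : ∀ U, CompactSpace (Q U) := fun U => H _ (hG.of_surjective (f U) (hf U) (hs U))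
  let p : G →* ∀ U, Q U := MonoidHom.pi f
  have hp : Continuous p := continuous_pi hf
  have hi : IsInducing p := by
    rw [IsTopologicalGroup.isInducing_iff_nhds_one]
    refine le_antisymm (by simpa using (hp.tendsto 1).le_comap) fun U hU => ?_
    refine ⟨(fun q => q ⟨U, hU⟩) ⁻¹' V ⟨U, hU⟩,
      (continuous_apply _).continuousAt.preimage_mem_nhds (hV _), hVU ⟨U, hU⟩⟩
  have hcl := hG.isClosed_range p hp
  rw [← isCompact_univ_iff, hi.isCompact_iff, image_univ]
  exact hcl.isCompact

theorem exists_lt_inv_mul_mem_of_compactSpace [CompactSpace G] {U : Set G} (hU : U ∈ 𝓝 1)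
    (x : ℕ → G) : ∃ m n, m < n ∧ (x m)⁻¹ * x n ∈ U := by
  obtain ⟨a, ha⟩ : ∃ a, MapClusterPt a atTop x := by
    obtain ⟨a, -, ha⟩ := isCompact_univ.exists_mapClusterPt (f := atTop) (u := x) (by simp)
    exact ⟨a, ha⟩
  have h : Tendsto (fun p : G × G => p.1⁻¹ * p.2) (𝓝 a ×ˢ 𝓝 a) (𝓝 1) := by
    simpa using (tendsto_fst (f := 𝓝 a) (g := 𝓝 a)).inv.mul tendsto_snd
  obtain ⟨W, hW, W', hW', hWW⟩ := mem_prod_iff.1 (h hU)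
  obtain ⟨m, -, hm⟩ := frequently_atTop.1 (ha.frequently hW) 0
  obtain ⟨n, hn, hn'⟩ := frequently_atTop.1 (ha.frequently hW') (m + 1)
  exact ⟨m, n, hn, hWW (mk_mem_prod hm hn')⟩

theorem IsCCompactGroup.compactSpace_of_forall_secondCountable [T2Space G]
    (H : ∀ (Q : Type u) [Group Q] [TopologicalSpace Q] [IsTopologicalGroup Q] [T2Space Q]
      [SecondCountableTopology Q], IsCCompactGroup Q → CompactSpace Q)
    (hG : IsCCompactGroup G) : CompactSpace G := by
  refine hG.compactSpace_of_isOmegaNarrow H ?_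
  by_contra hω
  obtain ⟨U, hU, x, hx⟩ := exists_seq_inv_mul_notMem_of_not_isOmegaNarrow hω
  -- The subgroup generated by the sequence, as the image of a countable group.
  let w := (FreeGroup.lift x).range
  let D := w.topologicalClosure
  have hD : IsClosed (D : Set G) := w.isClosed_topologicalClosure
  have hxD : ∀ n, x n ∈ D := fun n =>
    w.le_topologicalClosure ⟨FreeGroup.of n, FreeGroup.lift_apply_of⟩
  have hsep : TopologicalSpace.SeparableSpace D := by
    have : Countable (FreeGroup ℕ) := inferInstanceAs (Countable (Quot _))
    have : Countable w := (countable_range (FreeGroup.lift x)).to_subtype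
    exact (denseRange_inclusion_iff (t := (D : Set G)) w.le_topologicalClosure).2 subset_rfl
      |>.separableSpace (continuous_inclusion _)
  have := (hG.subgroup D hD).compactSpace_of_isOmegaNarrow H isOmegaNarrow_of_separableSpace
  obtain ⟨m, n, hmn, h⟩ := exists_lt_inv_mul_mem_of_compactSpace (G := D)
    (U := Subtype.val ⁻¹' U) (continuous_subtype_val.continuousAt.preimage_mem_nhds hU)
    fun n => ⟨x n, hxD n⟩
  exact hx m n hmn h

end Reduction

/-! ### Extensions of compact groups by compact groups -/

section CompactExtension

variable {G : Type*} [Group G] [TopologicalSpace G] [IsTopologicalGroup G]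

/-- The quotient map by a compact subgroup is proper. -/
theorem compactSpace_of_compactSpace_quotient (K : Subgroup G) (hK : IsCompact (K : Set G))
    [CompactSpace (G ⧸ K)] : CompactSpace G := by
  have hp : IsProperMap ((↑) : G → G ⧸ K) := by
    refine isProperMap_iff_isClosedMap_and_compact_fibers.2
      ⟨continuous_quotient_mk', QuotientGroup.isClosedMap_coe hK, fun y => ?_⟩
    obtain ⟨g, rfl⟩ := QuotientGroup.mk_surjective y
    rw [← image_singleton, QuotientGroup.preimage_image_mk_eq_mul]
    exact isCompact_singleton.mul hK
  exact ⟨by simpa using hp.isCompact_preimage isCompact_univ⟩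

/-- If `G ⧸ N` and `N ⧸ M` are compact, then so is `G ⧸ M`. The image `K` of `N` in `G ⧸ M` is a
compact subgroup whose quotient is an image of `G ⧸ N`. -/
theorem compactSpace_quotient_map_subtype (N : Subgroup G) [CompactSpace (G ⧸ N)]
    (M : Subgroup N) [CompactSpace (N ⧸ M)] [(M.map N.subtype).Normal] :
    CompactSpace (G ⧸ M.map N.subtype) := by
  let L := M.map N.subtype
  let K : Subgroup (G ⧸ L) := N.map (QuotientGroup.mk' L)
  let i : N ⧸ M → G ⧸ L := Quotient.lift (fun n : N => ((n : G) : G ⧸ L)) fun a b hab =>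
    QuotientGroup.eq.2 ⟨a⁻¹ * b, QuotientGroup.leftRel_apply.1 hab, rfl⟩
  have hi : Continuous i :=
    Continuous.quotient_lift (continuous_quotient_mk'.comp continuous_subtype_val) _
  have hK : IsCompact (K : Set (G ⧸ L)) := by
    convert isCompact_range hi
    ext y
    constructor
    · rintro ⟨n, hn, rfl⟩
      exact ⟨((⟨n, hn⟩ : N) : N ⧸ M), rfl⟩
    · rintro ⟨q, rfl⟩
      obtain ⟨n, rfl⟩ := QuotientGroup.mk_surjective q
      exact ⟨n, n.2, rfl⟩
  let p : G ⧸ N → (G ⧸ L) ⧸ K := Quotient.lift (fun g : G => ((g : G ⧸ L) : (G ⧸ L) ⧸ K))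
    fun a b hab => QuotientGroup.eq.2 ⟨a⁻¹ * b, QuotientGroup.leftRel_apply.1 hab, rfl⟩
  have hp : Continuous p :=
    Continuous.quotient_lift (continuous_quotient_mk'.comp continuous_quotient_mk') _
  have hps : Function.Surjective p := fun y => by
    obtain ⟨x, rfl⟩ := QuotientGroup.mk_surjective y
    obtain ⟨g, rfl⟩ := QuotientGroup.mk_surjective x
    exact ⟨(g : G ⧸ N), rfl⟩
  have := hps.compactSpace hp
  exact compactSpace_of_compactSpace_quotient K hK

end CompactExtension

/-! ### The compact residual and the von Neumann kernel -/

section Kernels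

variable (G : Type u) [Group G] [TopologicalSpace G]

/-- The intersection of all closed normal subgroups with compact quotient. -/
def compactResidual : Subgroup G :=
  sInf {M | IsClosed (M : Set G) ∧ M.Normal ∧ CompactSpace (G ⧸ M)}

/-- The intersection of the kernels of all continuous finite-dimensional unitary representations. -/
def vonNeumannKernel : Subgroup G :=
  ⨅ (n : ℕ) (ρ : G →* Matrix.unitaryGroup (Fin n) ℂ) (_ : Continuous ρ), ρ.ker

variable {G}

theorem mem_vonNeumannKernel {g : G} : g ∈ vonNeumannKernel G ↔
    ∀ (n : ℕ) (ρ : G →* Matrix.unitaryGroup (Fin n) ℂ), Continuous ρ → ρ g = 1 := by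
  simp [vonNeumannKernel, Subgroup.mem_iInf, MonoidHom.mem_ker]

instance : (vonNeumannKernel G).Normal :=
  Subgroup.normal_iInf_normal fun _ => Subgroup.normal_iInf_normal fun _ =>
    Subgroup.normal_iInf_normal fun _ => inferInstance

instance : (compactResidual G).Normal := by
  rw [compactResidual, sInf_eq_iInf]
  exact Subgroup.normal_iInf_normal fun _ => Subgroup.normal_iInf_normal fun h => h.2.1

theorem isClosed_compactResidual : IsClosed (compactResidual G : Set G) := by
  rw [compactResidual, Subgroup.coe_sInf]
  exact isClosed_biInter fun _ h => h.1

theorem isClosed_vonNeumannKernel : IsClosed (vonNeumannKernel G : Set G) := by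
  simp only [vonNeumannKernel, Subgroup.coe_iInf]
  exact isClosed_iInter fun n => isClosed_iInter fun ρ => isClosed_iInter fun hρ =>
    (isClosed_singleton (x := (1 : Matrix.unitaryGroup (Fin n) ℂ))).preimage hρ

theorem compactSpace_unitaryGroup (n : ℕ) : CompactSpace (Matrix.unitaryGroup (Fin n) ℂ) := by
  have h : IsCompact (univ.pi fun _ => univ.pi fun _ => Metric.closedBall 0 1 :
      Set (Fin n → Fin n → ℂ)) :=
    isCompact_univ_pi fun _ => isCompact_univ_pi fun _ => isCompact_closedBall _ _
  have hU : (Matrix.unitaryGroup (Fin n) ℂ : Set (Matrix (Fin n) (Fin n) ℂ)) =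
      {A | A * star A = 1} := by
    ext A
    exact Matrix.mem_unitaryGroup_iff
  have hc : IsCompact (Matrix.unitaryGroup (Fin n) ℂ : Set (Matrix (Fin n) (Fin n) ℂ)) := by
    refine h.of_isClosed_subset ?_ fun A hA i _ j _ => ?_
    · rw [hU]
      exact isClosed_eq (continuous_id.matrix_mul continuous_id.star) continuous_const
    · simpa using entry_norm_bound_of_unitary hA i j
  exact isCompact_iff_compactSpace.1 hc

/-- The von Neumann kernel is invariant under topological automorphisms, in particular under those
that conjugation in `G` induces on `N`. -/
theorem map_subtype_vonNeumannKernel_normal [IsTopologicalGroup G] (N : Subgroup G) [N.Normal] :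
    ((vonNeumannKernel N).map N.subtype).Normal := by
  refine ⟨?_⟩
  rintro _ ⟨n, hn, rfl⟩ g
  refine ⟨MulAut.conjNormal g n, mem_vonNeumannKernel.2 fun k ρ hρ => ?_, by simp⟩
  have hc : Continuous (MulAut.conjNormal g : N → N) := by
    refine Continuous.subtype_mk ?_ _
    fun_prop
  exact mem_vonNeumannKernel.1 hn k (ρ.comp (MulAut.conjNormal g : N ≃* N).toMonoidHom) (hρ.comp hc)

theorem isMaximallyAlmostPeriodic_quotient_of_ker_eq {P : Type u} [Group P] [TopologicalSpace P]
    [IsTopologicalGroup P] [T2Space P] [CompactSpace P] (f : G →* P) (hf : Continuous f)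
    (N : Subgroup G) [N.Normal] (hN : f.ker = N) : IsMaximallyAlmostPeriodic (G ⧸ N) := by
  subst hN
  exact ⟨P, _, _, ‹_›, ‹_›, ‹_›, QuotientGroup.kerLift f, Continuous.quotient_lift hf _,
    QuotientGroup.kerLift_injective f⟩

theorem isMaximallyAlmostPeriodic_quotient_vonNeumannKernel :
    IsMaximallyAlmostPeriodic (G ⧸ vonNeumannKernel G) := by
  have := compactSpace_unitaryGroup
  refine isMaximallyAlmostPeriodic_quotient_of_ker_eq
    (MonoidHom.pi fun i : Σ n, {ρ : G →* Matrix.unitaryGroup (Fin n) ℂ // Continuous ρ} => i.2.1)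
    (continuous_pi fun i => i.2.2) _ ?_
  ext g
  simp only [MonoidHom.mem_ker, mem_vonNeumannKernel, funext_iff, MonoidHom.pi_apply,
    Pi.one_apply, Sigma.forall, Subtype.forall]

variable [IsTopologicalGroup G]

theorem isMaximallyAlmostPeriodic_quotient_compactResidual :
    IsMaximallyAlmostPeriodic (G ⧸ compactResidual G) := by
  let ι := {M : Subgroup G // IsClosed (M : Set G) ∧ M.Normal ∧ CompactSpace (G ⧸ M)}
  have h1 (i : ι) : i.1.Normal := i.2.2.1
  have h2 (i : ι) : IsClosed (i.1 : Set G) := i.2.1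
  have h3 (i : ι) : CompactSpace (G ⧸ i.1) := i.2.2.2
  refine isMaximallyAlmostPeriodic_quotient_of_ker_eq
    (MonoidHom.pi fun i : ι => QuotientGroup.mk' i.1)
    (continuous_pi fun i => continuous_quotient_mk') _ ?_
  ext g
  simp only [compactResidual, Subgroup.mem_sInf, MonoidHom.mem_ker, funext_iff,
    MonoidHom.pi_apply, Pi.one_apply, QuotientGroup.mk'_apply, QuotientGroup.eq_one_iff]
  exact Subtype.forall

variable [SecondCountableTopology G]

theorem IsCCompactGroup.compactSpace_quotient_compactResidual (hG : IsCCompactGroup G) :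
    CompactSpace (G ⧸ compactResidual G) := by
  have := isClosed_compactResidual (G := G)
  exact (hG.quotient _).compactSpace_of_isMaximallyAlmostPeriodic
    isMaximallyAlmostPeriodic_quotient_compactResidual

theorem IsCCompactGroup.compactSpace_quotient_vonNeumannKernel (hG : IsCCompactGroup G) :
    CompactSpace (G ⧸ vonNeumannKernel G) := by
  have := isClosed_vonNeumannKernel (G := G)
  exact (hG.quotient _).compactSpace_of_isMaximallyAlmostPeriodic
    isMaximallyAlmostPeriodic_quotient_vonNeumannKernel

/-- The von Neumann kernel of the compact residual `N` is a closed normal subgroup of `G` with compact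
quotient, so it contains `N`. -/
theorem IsCCompactGroup.isMinimallyAlmostPeriodic_compactResidual (hG : IsCCompactGroup G) :
    IsMinimallyAlmostPeriodic (compactResidual G) := by
  have hN := isClosed_compactResidual (G := G)
  have : SecondCountableTopology (compactResidual G) :=
    TopologicalSpace.Subtype.secondCountableTopology _
  have := hG.compactSpace_quotient_compactResidual
  have := (hG.subgroup _ hN).compactSpace_quotient_vonNeumannKernel
  have hnormal := map_subtype_vonNeumannKernel_normal (compactResidual G)
  have hle : compactResidual G ≤ (vonNeumannKernel (compactResidual G)).map
      (compactResidual G).subtype := by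
    refine sInf_le ⟨?_, hnormal, compactSpace_quotient_map_subtype _ _⟩
    exact hN.isClosedEmbedding_subtypeVal.isClosedMap _ isClosed_vonNeumannKernel
  intro n ρ hρ g
  obtain ⟨g', hg', h⟩ := hle g.2
  rw [← Subtype.ext h]
  exact mem_vonNeumannKernel.1 hg' n ρ hρ

end Kernels

/-! ### The equivalence -/

theorem mainTheorem4 :
    List.TFAE [
      ∀ (G : Type u) [Group G] [TopologicalSpace G] [IsTopologicalGroup G] [T2Space G],
        IsCCompactGroup G → CompactSpace G,
      ∀ (G : Type u) [Group G] [TopologicalSpace G] [IsTopologicalGroup G] [T2Space G]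
        [SecondCountableTopology G], IsCCompactGroup G → IsMaximallyAlmostPeriodic G,
      ∀ (G : Type u) [Group G] [TopologicalSpace G] [IsTopologicalGroup G] [T2Space G]
        [SecondCountableTopology G],
        IsCCompactGroup G → IsMinimallyAlmostPeriodic G → Subsingleton G] ∧
    ∀ (G : Type u) [Group G] [TopologicalSpace G] [IsTopologicalGroup G] [T2Space G]
      [SecondCountableTopology G],
      IsCCompactGroup G → IsMaximallyAlmostPeriodic G → CompactSpace G := by
  refine ⟨?_, fun G _ _ _ _ _ hG h => hG.compactSpace_of_isMaximallyAlmostPeriodic h⟩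
  tfae_have 1 → 2 := fun h G _ _ _ _ _ hG =>
    ⟨G, _, _, ‹_›, ‹_›, h G hG, MonoidHom.id G, continuous_id, Function.injective_id⟩
  tfae_have 2 → 3 := by
    intro h G _ _ _ _ _ hG hmap
    have := hG.compactSpace_of_isMaximallyAlmostPeriodic (h G hG)
    refine subsingleton_of_forall_eq 1 fun g => ?_
    by_contra hg
    obtain ⟨n, ρ, hρ, hne⟩ := exists_unitary_matrix_hom_ne_one_of_compactSpace hg
    exact hne (hmap n ρ hρ g)
  tfae_have 3 → 1 := by
    intro h G _ _ _ _ hG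
    refine hG.compactSpace_of_forall_secondCountable fun Q _ _ _ _ _ hQ => ?_
    have : SecondCountableTopology (compactResidual Q) :=
      TopologicalSpace.Subtype.secondCountableTopology _
    have := h (compactResidual Q) (hQ.subgroup _ isClosed_compactResidual)
      hQ.isMinimallyAlmostPeriodic_compactResidual
    have : Finite (compactResidual Q) := Finite.of_subsingleton
    have := hQ.compactSpace_quotient_compactResidual
    exact compactSpace_of_compactSpace_quotient (compactResidual Q)
      (Set.toFinite (compactResidual Q : Set Q)).isCompact
  tfae_finish
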